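/- Call a subgroup $F$ of a group $X$ finitely separable in $X$ if for every $x\in X\setminus F$ there is a homomorphism $\psi$ of $X$ onto a finite group with $\psi(x)\notin\psi(F)$. A group is residually finite if its trivial subgroup is finitely separable, and it is a $\pi_c$-group if all its cyclic subgroups are finitely separable. Let $A$ and $B$ be groups, $H\le A$ and $K\le B$ subgroups, $\varphi\colon H\to K$ an isomorphism, and let $G=(A*B;\,H=K,\varphi)$ be the free product of $A$ and $B$ with $H$ and $K$ amalgamated according to $\varphi$; regard $A$ and $B$ as subgroups of $G$. Let $\Omega$ be the set of all pairs $(R,S)$, where $R$ is a normal subgroup of finite index of $A$, $S$ is a normal subgroup of finite index of $B$, and $\varphi(R\cap H)=S\cap K$. **Theorem 1.3.** Suppose that $A$ and $B$ are residually finite, that $H$ is finitely separable in $A$ and $K$ is finitely separable in $B$, and that for all normal subgroups of finite index $M\le A$ and $N\le B$ there is a pair $(R,S)\in\Omega$ with $R\le M$ and $S\le N$. Then every cyclic subgroup of $G$ that is not conjugate in $G$ to a cyclic subgroup of $A$ that is not finitely separable in $A$, nor to a cyclic subgroup of $B$ that is not finitely separable in $B$, is finitely separable in $G$. In particular, if $A$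 and $B$ are $\pi_c$-groups, then $G$ is a $\pi_c$-group. -/

import Mathlib

universe u

/-- A subgroup `F` of `G` is finitely separable if every element outside `F` can be kept outside
the image of `F` under a homomorphism of `G` onto some finite group. -/
def IsFinitelySeparable {G : Type u} [Group G] (F : Subgroup G) : Prop :=
  ∀ g : G, g ∉ F → ∃ (Q : Type u) (_ : Group Q) (_ : Finite Q) (ψ : G →* Q),
    Function.Surjective ψ ∧ ψ g ∉ F.map ψ

/-- A `π_c`-group: all cyclic subgroups are finitely separable. -/
def IsPiC (G : Type u) [Group G] : Prop :=
  ∀ C : Subgroup G, IsCyclic C → IsFinitelySeparable C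

/-- The family of all cyclic subgroups of `X` that are not finitely separable in `X`. -/
def nonSeparableCyclic (X : Type u) [Group X] : Set (Subgroup X) :=
  {D | IsCyclic D ∧ ¬ IsFinitelySeparable D}

/-- The subgroups `C` and `D` of `G` are conjugate: `C = g D g⁻¹` for some `g`. -/
def AreConjugate {G : Type u} [Group G] (C D : Subgroup G) : Prop :=
  ∃ g : G, C = D.map (MulAut.conj g).toMonoidHom

namespace Amalgam

/-- The pair of groups `A`, `B` as a family indexed by `Bool`. -/
def Factor (A B : Type u) : Bool → Type u
  | false => A
  | true => B

instance factorGroup (A B : Type u) [Group A] [Group B] : ∀ i : Bool, Group (Factor A B i)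
  | false => inferInstanceAs (Group A)
  | true => inferInstanceAs (Group B)

variable {A B : Type u} [Group A] [Group B] (H : Subgroup A) (K : Subgroup B) (φ : H ≃* K)

/-- The two embeddings of `H`: the inclusion into `A`, and `φ` followed by `K ≤ B`. -/
def embed : ∀ i : Bool, H →* Factor A B i
  | false => H.subtype
  | true => K.subtype.comp φ.toMonoidHom

/-- The free product `(A * B; H = K, φ)` of `A` and `B` with the subgroups `H` and `K`
amalgamated according to `φ`, as the pushout of `A ← H → B`. -/
abbrev Product : Type u := Monoid.PushoutI (embed H K φ)

/-- The canonical map of the factor `A` into the amalgamated product. -/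
def inA : A →* Product H K φ := Monoid.PushoutI.of (φ := embed H K φ) false

/-- The canonical map of the factor `B` into the amalgamated product. -/
def inB : B →* Product H K φ := Monoid.PushoutI.of (φ := embed H K φ) true

/-- `R ≤ A` and `S ≤ B` are `(H, K, φ)`-compatible: `φ (R ∩ H) = S ∩ K`. -/
def Compatible (R : Subgroup A) (S : Subgroup B) : Prop :=
  (R.subgroupOf H).map φ.toMonoidHom = S.subgroupOf K

/-- The family `Ω` of all `(H, K, φ)`-compatible pairs of normal subgroups of finite index. -/
def compatiblePairs : Set (Subgroup A × Subgroup B) :=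
  {p | p.1.Normal ∧ p.1.FiniteIndex ∧ p.2.Normal ∧ p.2.FiniteIndex ∧ Compatible H K φ p.1 p.2}

end Amalgam

/-! A compatible pair (R, S) gives a homomorphism from G to the amalgam of the finite groups A/R and
B/S over the common quotient of H. Two facts suffice: amalgams of finite groups are π_c
(`isPiC_pushoutI_of_finite`), and for small enough (R, S) a given g outside ⟨c⟩ stays outside the
image of ⟨c⟩.

For the first, let c have infinite order. Finite factors act freely on the cosets of ⟨c⟩, and
`exists_finite_model` completes a finite piece of this action to an action on a finite set, where c
fixes a point that g moves. If c has finite order, residual finiteness is enough; it follows in the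
same way from the regular action.

For the second, conjugate c into a factor or to a cyclically reduced element. In a factor,
separability of ⟨c⟩ there handles g in that factor; any other g keeps its reduced form in the
quotient and stays outside the factor. If c is cyclically reduced, the length of its k-th power
grows with |k| even in the quotient, so only finitely many powers can meet the image of g, and
residual finiteness excludes each of them. -/

open Subgroup

/-! ### Finite separability and its transfer along homomorphisms -/

section Separability

variable {G : Type u} [Group G] {F : Subgroup G}

theorem isFinitelySeparable_iff :
    IsFinitelySeparable F ↔
      ∀ g, g ∉ F → ∃ N : FiniteIndexNormalSubgroup G, ∀ f ∈ F, f⁻¹ * g ∉ N := by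
  refine forall₂_congr fun g _ => ⟨?_, ?_⟩
  · rintro ⟨Q, _, _, ψ, -, h⟩
    have : ψ.ker.FiniteIndex := finiteIndex_ker ψ
    refine ⟨.ofSubgroup ψ.ker, fun f hf hfg => h ⟨f, hf, ?_⟩⟩
    have h1 : ψ (f⁻¹ * g) = 1 := hfg
    rwa [map_mul, map_inv, inv_mul_eq_one] at h1
  · rintro ⟨N, h⟩
    refine ⟨G ⧸ N.toSubgroup, inferInstance, inferInstance, QuotientGroup.mk' _,
      QuotientGroup.mk'_surjective _, ?_⟩
    rintro ⟨f, hf, hfg⟩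
    exact h f hf (QuotientGroup.eq.1 hfg)

/-- Separability may be checked after mapping into groups in which the image is separable. -/
theorem isFinitelySeparable_of_hom
    (h : ∀ g, g ∉ F → ∃ (X : Type u) (_ : Group X) (f : G →* X),
      f g ∉ F.map f ∧ IsFinitelySeparable (F.map f)) : IsFinitelySeparable F := by
  rw [isFinitelySeparable_iff]
  intro g hg
  obtain ⟨X, _, f, hfg, hs⟩ := h g hg
  obtain ⟨N, hN⟩ := isFinitelySeparable_iff.1 hs _ hfg
  refine ⟨N.comap f, fun y hy hyg => hN _ ⟨y, hy, rfl⟩ ?_⟩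
  have h1 : f (y⁻¹ * g) ∈ N := hyg
  simpa using h1

theorem isFinitelySeparable_of_finite [Finite G] : IsFinitelySeparable F := by
  intro g hg
  refine ⟨G, inferInstance, inferInstance, MonoidHom.id G, Function.surjective_id, ?_⟩
  simpa using hg

theorem isFinitelySeparable_map_of_bijective {X : Type u} [Group X] (f : G ≃* X)
    (h : IsFinitelySeparable F) : IsFinitelySeparable (F.map f.toMonoidHom) := by
  apply isFinitelySeparable_of_hom
  intro x hx
  have h1 : (F.map f.toMonoidHom).map f.symm.toMonoidHom = F := by
    ext y
    simp [Subgroup.mem_map]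
  refine ⟨G, inferInstance, f.symm.toMonoidHom, ?_, h1.symm ▸ h⟩
  rw [h1]
  exact fun h2 => hx ⟨f.symm x, h2, by simp⟩

theorem isFinitelySeparable_zpowers_of_conj {c x : G}
    (h : IsFinitelySeparable (zpowers (x * c * x⁻¹))) : IsFinitelySeparable (zpowers c) := by
  have h1 := isFinitelySeparable_map_of_bijective (MulAut.conj x⁻¹) h
  rw [MonoidHom.map_zpowers] at h1
  simpa [mul_assoc] using h1

/-- Finite subgroups of residually finite groups are finitely separable. -/
theorem isFinitelySeparable_of_finite_subgroup [Group.ResiduallyFinite G]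
    (hF : (F : Set G).Finite) : IsFinitelySeparable F := by
  rw [isFinitelySeparable_iff]
  intro g hg
  have : Nonempty (FiniteIndexNormalSubgroup G) := ⟨.ofSubgroup ⊤⟩
  have h (f : G) (hf : f ∈ F) : ∃ N : FiniteIndexNormalSubgroup G, f⁻¹ * g ∉ N :=
    Group.exists_finiteIndexNormalSubgroup_notMem _ fun h1 =>
      hg (by rwa [inv_mul_eq_one.1 h1] at hf)
  choose! N hN using h
  obtain ⟨M, hM⟩ := (hF.image N).bddBelow
  exact ⟨M, fun f hf hfg => hN f hf (hM ⟨f, hf, rfl⟩ hfg)⟩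

end Separability

/-! ### Completing partial free actions of finite groups -/

section FreeActions

/-- Every orbit of a free action is a copy of the regular one, so the cardinality, which counts the
orbits, determines the action. -/
theorem exists_equivariant_equiv_sigma {U X : Type*} [Group U] [Finite U] [MulAction U X]
    [Finite X] (hfree : ∀ (u : U) (x : X), u • x = x → u = 1) {t : ℕ}
    (hcard : Nat.card X = Nat.card U * t) :
    ∃ e : X ≃ (Σ _ : Fin t, U), ∀ (u : U) (x : X), e (u • x) = u • e x := by
  have hst (b : X) : MulAction.stabilizer U b = ⊥ := by
    rw [Subgroup.eq_bot_iff_forall]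
    exact fun u hu => hfree u b hu
  have hq : Nat.card (MulAction.orbitRel.Quotient U X) = t := by
    have h1 := Nat.card_congr (MulAction.selfEquivOrbitsQuotientProd hst)
    rw [hcard, Nat.card_prod, mul_comm] at h1
    exact (Nat.eq_of_mul_eq_mul_right Nat.card_pos h1).symm
  let q : MulAction.orbitRel.Quotient U X ≃ Fin t := (Finite.equivFin _).trans (finCongr hq)
  let f : (Σ _ : Fin t, U) → X := fun z => z.2 • (q.symm z.1).out
  have hmk (z) : (Quotient.mk'' (f z) : MulAction.orbitRel.Quotient U X) = q.symm z.1 := by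
    rw [← Quotient.out_eq' (q.symm z.1)]
    exact Quotient.sound' ⟨z.2, rfl⟩
  have hf : Function.Bijective f := by
    constructor
    · rintro ⟨i, u⟩ ⟨i', u'⟩ h
      have h1 : i = i' := q.symm.injective (by rw [← hmk ⟨i, u⟩, h, hmk])
      subst h1
      have h2 : (u'⁻¹ * u) • (q.symm i).out = (q.symm i).out := by
        rw [mul_smul, inv_smul_eq_iff]
        exact h
      rw [inv_mul_eq_one.1 (hfree _ _ h2)]
    · intro x
      obtain ⟨u, hu⟩ : x ∈ MulAction.orbit U
          (Quotient.mk'' x : MulAction.orbitRel.Quotient U X).out :=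
        MulAction.orbitRel_apply.1 (Quotient.exact' (Quotient.out_eq' _).symm)
      exact ⟨⟨q (Quotient.mk'' x), u⟩, by simpa [f] using hu⟩
  refine ⟨(Equiv.ofBijective f hf).symm, fun u x => ?_⟩
  obtain ⟨z, rfl⟩ := hf.2 x
  rw [Equiv.symm_apply_eq, Equiv.ofBijective_symm_apply_apply]
  simp only [f, Equiv.ofBijective_apply]
  exact (mul_smul u z.2 _).symm

/-- A `U`-set `F` embedded in a free `P`-set `Y`, where `U ≤ P`, can be completed by free
`U`-orbits to a `U`-set on which the action of `U` extends to `P`. -/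
theorem exists_perm_extension {U P F Y : Type*} [Group U] [Finite U] [Group P] [MulAction U F]
    [MulAction P Y] [Finite Y] (φ : U →* P) (hφ : Function.Injective φ)
    (hfree : ∀ (p : P) (y : Y), p • y = y → p = 1) (j : F → Y) (hj : Function.Injective j)
    (hju : ∀ (u : U) (x : F), j (u • x) = φ u • j x) {t : ℕ}
    (hcard : Nat.card Y = Nat.card F + Nat.card U * t) :
    ∃ f : P →* Equiv.Perm (F ⊕ (Σ _ : Fin t, U)),
      f.comp φ = MulAction.toPermHom U _ ∧
        ∀ (p : P) (x y : F), p • j x = j y → f p (Sum.inl x) = Sum.inl y := by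
  classical
  let _ : MulAction U Y := MulAction.compHom Y φ
  have hsm (u : U) (y : Y) : u • y = φ u • y := rfl
  -- The complement of the image of `j` is a free `U`-set with exactly `t` orbits, so `Y` is a model
  -- of the completed set and its `P`-action can be transported.
  let D : SubMulAction U Y :=
    { carrier := (Set.range j)ᶜ
      smul_mem' := by
        rintro u y hy ⟨x, hx⟩
        refine hy ⟨u⁻¹ • x, ?_⟩
        rw [hju, hx, hsm, map_inv, inv_smul_smul] }
  have : Finite F := Finite.of_injective j hj
  have hD : Nat.card D = Nat.card U * t := by
    have h1 := Nat.card_congr (Equiv.Set.sumCompl (Set.range j))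
    rw [Nat.card_sum, Nat.card_congr (Equiv.ofInjective j hj).symm, hcard] at h1
    exact Nat.add_left_cancel h1
  obtain ⟨e, he⟩ := exists_equivariant_equiv_sigma (U := U) (X := D)
    (fun u x h => hφ (by
      rw [map_one]
      exact hfree _ x.1 (congrArg Subtype.val h))) hD
  let E : F ⊕ (Σ _ : Fin t, U) ≃ Y :=
    (Equiv.sumCongr (Equiv.ofInjective j hj) e.symm).trans (Equiv.Set.sumCompl (Set.range j))
  have hEl (x : F) : E (Sum.inl x) = j x := rfl
  have hEr (d : D) : E (Sum.inr (e d)) = d.1 := by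
    change ((e.symm (e d)).1 : Y) = d.1
    rw [e.symm_apply_apply]
  have hE (u : U) (z) : E (u • z) = φ u • E z := by
    obtain x | z := z
    · rw [Sum.smul_inl, hEl, hEl, hju]
    · obtain ⟨d, rfl⟩ := e.surjective z
      rw [Sum.smul_inr, ← he, hEr, hEr]
      rfl
  refine ⟨E.symm.permCongrHom.toMonoidHom.comp (MulAction.toPermHom P Y), ?_, ?_⟩
  · ext1 u
    refine Equiv.ext fun z => ?_
    change E.symm (φ u • E z) = u • z
    rw [Equiv.symm_apply_eq, hE]
  · intro p x y h
    change E.symm (p • E (Sum.inl x)) = Sum.inl y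
    rw [Equiv.symm_apply_eq, hEl, hEl, h]

/-- The same with `F` an invariant finite subset of a free `P`-set `W`, the size being adjusted
by adding free `P`-orbits. -/
theorem exists_perm_extension_of_subset {U P F W : Type*} [Group U] [Finite U] [Group P]
    [Finite P] [MulAction U F] [Finite F]
    [MulAction P W] (φ : U →* P) (hφ : Function.Injective φ)
    (hfree : ∀ (p : P) (w : W), p • w = w → p = 1) (j : F → W) (hj : Function.Injective j)
    (hju : ∀ (u : U) (x : F), j (u • x) = φ u • j x) {t m : ℕ} (hm : Nat.card F ≤ m)
    (hcard : Nat.card P * m = Nat.card F + Nat.card U * t) :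
    ∃ f : P →* Equiv.Perm (F ⊕ (Σ _ : Fin t, U)),
      f.comp φ = MulAction.toPermHom U _ ∧
        ∀ (p : P) (x y : F), p • j x = j y → f p (Sum.inl x) = Sum.inl y := by
  let X : SubMulAction P W :=
    { carrier := Set.range fun z : P × F => z.1 • j z.2
      smul_mem' := by
        rintro p _ ⟨⟨q, x⟩, rfl⟩
        exact ⟨(p * q, x), mul_smul _ _ _⟩ }
  have hXfin : Finite X := Set.finite_range fun z : P × F => z.1 • j z.2
  have hst (b : X) : MulAction.stabilizer P b = ⊥ := by
    rw [Subgroup.eq_bot_iff_forall]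
    exact fun u hu => hfree u b.1 (congrArg Subtype.val hu)
  let i : F → X := fun x => ⟨j x, (1, x), one_smul _ _⟩
  let k := Nat.card (MulAction.orbitRel.Quotient P X)
  have hXcard : Nat.card X = Nat.card P * k := by
    rw [Nat.card_congr (MulAction.selfEquivOrbitsQuotientProd hst), Nat.card_prod, mul_comm]
  -- Every `P`-orbit in the saturation `X` meets the image of `F`; hence `m - k` further regular
  -- orbits bring the size up to `Nat.card P * m`.
  have hk : k ≤ m := by
    refine le_trans (Nat.card_le_card_of_surjective
      (fun x : F => (Quotient.mk'' (i x) : MulAction.orbitRel.Quotient P X)) ?_) hm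
    intro q
    induction q using Quotient.inductionOn' with
    | h w =>
      obtain ⟨_, ⟨p, x⟩, rfl⟩ := w
      exact ⟨x, Quotient.sound' ⟨p⁻¹, Subtype.ext (inv_smul_smul _ _)⟩⟩
  refine exists_perm_extension (Y := X ⊕ (Σ _ : Fin (m - k), P)) φ hφ ?_ (fun x => Sum.inl (i x))
    (fun x y h => hj (congrArg Subtype.val (Sum.inl_injective h))) ?_ ?_ |>.imp ?_
  · rintro p (w | ⟨n, q⟩) h
    · exact hfree p w.1 (congrArg Subtype.val (Sum.inl_injective h))
    · simpa [Sum.smul_inr] using h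
  · intro u x
    rw [Sum.smul_inl]
    exact congrArg Sum.inl (Subtype.ext (hju u x))
  · rw [← hcard, Nat.card_sum, hXcard, Nat.card_sigma]
    simp only [Finset.sum_const, Finset.card_univ, Fintype.card_fin, smul_eq_mul]
    rw [mul_comm (m - k), ← mul_add, Nat.add_sub_cancel' hk]
  · rintro f ⟨h1, h2⟩
    refine ⟨h1, fun p x y h => h2 p x y ?_⟩
    rw [Sum.smul_inl]
    exact congrArg Sum.inl (Subtype.ext h)

end FreeActions

/-! ### Amalgams of finite groups are π_c -/

section FinitePushout

open Monoid

variable {ι : Type} {G : ι → Type u} {U : Type u} [∀ i, Group (G i)] [Group U]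
  {φ : ∀ i, U →* G i}

/-- An action of the amalgam on a set `W`, free on the finite factors, is modelled on any finite
subset of `W` by an action on a finite set. -/
theorem exists_finite_model [Finite ι] [Nonempty ι] [∀ i, Finite (G i)]
    (hφ : ∀ i, Function.Injective (φ i)) {W : Type u} [MulAction (PushoutI φ) W]
    (hfree : ∀ (i : ι) (p : G i) (w : W), (PushoutI.of i p : PushoutI φ) • w = w → p = 1)
    {F₀ : Set W} (hF₀ : F₀.Finite) :
    ∃ (Z : Type u) (_ : Finite Z) (Φ : PushoutI φ →* Equiv.Perm Z) (F : Set W) (z : F → Z),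
      F₀ ⊆ F ∧ Function.Injective z ∧
        ∀ (i : ι) (p : G i) (x y : F), (PushoutI.of i p : PushoutI φ) • x.1 = y.1 →
          Φ (PushoutI.of i p) (z x) = z y := by
  have := Fintype.ofFinite ι
  classical
  obtain ⟨i₀⟩ := ‹Nonempty ι›
  have : Finite U := Finite.of_injective _ (hφ i₀)
  have : Finite F₀ := hF₀
  let _ (i : ι) : MulAction (G i) W := MulAction.compHom W (PushoutI.of (φ := φ) i)
  let _ : MulAction U W := MulAction.compHom W (PushoutI.base φ)
  have hsm (i : ι) (u : U) (w : W) : u • w = φ i u • w := by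
    change PushoutI.base φ u • w = (PushoutI.of i (φ i u) : PushoutI φ) • w
    rw [PushoutI.of_apply_eq_base]
  let F : SubMulAction U W :=
    { carrier := Set.range fun z : U × F₀ => z.1 • z.2.1
      smul_mem' := by
        rintro u _ ⟨⟨v, x⟩, rfl⟩
        exact ⟨(u * v, x), mul_smul _ _ _⟩ }
  have hFfin : Finite F := Set.finite_range fun z : U × F₀ => z.1 • z.2.1
  obtain ⟨f, hf⟩ : ∃ f, Nat.card F = Nat.card U * f := by
    have hst (b : F) : MulAction.stabilizer U b = ⊥ := by
      rw [Subgroup.eq_bot_iff_forall]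
      intro u hu
      apply hφ i₀
      rw [map_one]
      refine hfree i₀ _ b.1 ?_
      exact (hsm i₀ u b.1).symm.trans (congrArg Subtype.val hu)
    refine ⟨Nat.card (MulAction.orbitRel.Quotient U F), ?_⟩
    rw [Nat.card_congr (MulAction.selfEquivOrbitsQuotientProd hst), Nat.card_prod, mul_comm]
  -- Adding `t` free `U`-orbits makes the size `Nat.card F * n`, a multiple of every factor's order,
  -- so one set serves all factors. The factor actions agree on `U` and therefore glue.
  let n := ∏ i, Nat.card (G i)
  have hn : 1 ≤ n := Finset.prod_pos fun i _ => Nat.card_pos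
  let t := f * (n - 1)
  have ht : Nat.card F + Nat.card U * t = Nat.card F * n := by
    obtain ⟨n', hn'⟩ := Nat.exists_eq_add_of_le hn
    simp only [t, hn', hf, Nat.add_sub_cancel_left]
    ring
  have h (i : ι) : ∃ g : G i →* Equiv.Perm (F ⊕ (Σ _ : Fin t, U)),
      g.comp (φ i) = MulAction.toPermHom U _ ∧
        ∀ (p : G i) (x y : F), p • x.1 = y.1 → g p (Sum.inl x) = Sum.inl y := by
    refine exists_perm_extension_of_subset (m := Nat.card F * ∏ j ∈ Finset.univ.erase i,
      Nat.card (G j)) (φ i) (hφ i) (hfree i) Subtype.val Subtype.val_injective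
      (fun u x => hsm i u x.1) ?_ ?_
    · exact Nat.le_mul_of_pos_right _ (Finset.prod_pos fun i _ => Nat.card_pos)
    · rw [ht, mul_left_comm, Finset.mul_prod_erase _ (fun j => Nat.card (G j)) (Finset.mem_univ i)]
  choose g hg hg' using h
  refine ⟨F ⊕ (Σ _ : Fin t, U), inferInstance, PushoutI.lift g _ hg, F, Sum.inl, ?_,
    Sum.inl_injective, ?_⟩
  · exact fun w hw => ⟨(1, ⟨w, hw⟩), one_smul _ _⟩
  · intro i p x y h
    rw [PushoutI.lift_of]
    exact hg' i p x y h

/-- A model on a large enough subset computes the translate of `w` by `g`. -/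
theorem exists_finite_forall_model [Nonempty ι] {W : Type u} [MulAction (PushoutI φ) W]
    (g : PushoutI φ) (w : W) :
    ∃ F₀ : Set W, F₀.Finite ∧ ∀ (Z : Type u) (Φ : PushoutI φ →* Equiv.Perm Z) (F : Set W)
      (z : F → Z), F₀ ⊆ F →
        (∀ (i : ι) (p : G i) (x y : F), (PushoutI.of i p : PushoutI φ) • x.1 = y.1 →
          Φ (PushoutI.of i p) (z x) = z y) →
        ∀ x y : F, x.1 = w → g • x.1 = y.1 → Φ g (z x) = z y := by
  induction g using PushoutI.induction_on generalizing w with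
  | of i p => exact ⟨∅, Set.finite_empty, fun Z Φ F z _ h x y _ hxy => h i p x y hxy⟩
  | base u =>
    obtain ⟨i⟩ := ‹Nonempty ι›
    refine ⟨∅, Set.finite_empty, fun Z Φ F z _ h x y _ hxy => ?_⟩
    rw [← PushoutI.of_apply_eq_base φ i] at hxy ⊢
    exact h i _ x y hxy
  | mul a b iha ihb =>
    obtain ⟨Fb, hFb, hb⟩ := ihb w
    obtain ⟨Fa, hFa, ha⟩ := iha (b • w)
    -- The intermediate point `b • w` must lie in the model for the two steps to compose.
    refine ⟨insert (b • w) (Fa ∪ Fb), (hFa.union hFb).insert _, ?_⟩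
    rintro Z Φ F z hF h x y rfl hxy
    have hm : b • x.1 ∈ F := hF (Set.mem_insert _ _)
    rw [map_mul, Equiv.Perm.mul_apply,
      hb Z Φ F z (fun _ h' => hF (Or.inr (Or.inr h'))) h x ⟨_, hm⟩ rfl rfl]
    exact ha Z Φ F z (fun _ h' => hF (Or.inr (Or.inl h'))) h ⟨_, hm⟩ y rfl (by
      rw [← hxy, mul_smul])

/-- Two points in the same orbit of an action free on the finite factors can be separated, while
keeping the first one fixed by one of its stabilizing elements. -/
theorem exists_finite_hom_fix_move [Finite ι] [Nonempty ι] [∀ i, Finite (G i)]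
    (hφ : ∀ i, Function.Injective (φ i)) {W : Type u} [MulAction (PushoutI φ) W]
    (hfree : ∀ (i : ι) (p : G i) (w : W), (PushoutI.of i p : PushoutI φ) • w = w → p = 1)
    (w : W) {c g : PushoutI φ} (hc : c • w = w) (hg : g • w ≠ w) :
    ∃ (Z : Type u) (_ : Finite Z) (Φ : PushoutI φ →* Equiv.Perm Z) (z : Z),
      Φ c z = z ∧ Φ g z ≠ z := by
  obtain ⟨Fc, hFc, hc'⟩ := exists_finite_forall_model c w
  obtain ⟨Fg, hFg, hg'⟩ := exists_finite_forall_model g w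
  obtain ⟨Z, hZ, Φ, F, z, hF, hz, h⟩ := exists_finite_model hφ hfree
    (((hFc.union hFg).insert (g • w)).insert w)
  have hw : w ∈ F := hF (by simp)
  have hgw : g • w ∈ F := hF (by simp)
  refine ⟨Z, hZ, Φ, z ⟨w, hw⟩, ?_, ?_⟩
  · exact hc' Z Φ F z (fun _ h' => hF (Or.inr (Or.inr (Or.inl h')))) h _ _ rfl hc
  · rw [hg' Z Φ F z (fun _ h' => hF (Or.inr (Or.inr (Or.inr h')))) h ⟨w, hw⟩ ⟨_, hgw⟩ rfl rfl]
    exact fun h' => hg (congrArg Subtype.val (hz h'))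

theorem residuallyFinite_pushoutI_of_finite [Finite ι] [Nonempty ι] [∀ i, Finite (G i)]
    (hφ : ∀ i, Function.Injective (φ i)) : Group.ResiduallyFinite (PushoutI φ) := by
  refine Group.residuallyFinite_of_forall_exists_finite_monoidHom.{u} fun g hg => ?_
  obtain ⟨Z, hZ, Φ, z, -, h⟩ := exists_finite_hom_fix_move (W := PushoutI φ) hφ
    (fun i p w h => by
      rw [smul_eq_mul, mul_eq_right] at h
      exact PushoutI.of_injective hφ i (h.trans (map_one _).symm))
    1 (c := 1) (g := g) (one_smul _ _) (by simpa using hg)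
  refine ⟨Equiv.Perm Z, inferInstance, inferInstance, Φ, fun h1 => h ?_⟩
  rw [h1, Equiv.Perm.one_apply]

/-- An amalgam of finitely many finite groups is a `π_c`-group. -/
theorem isPiC_pushoutI_of_finite [Finite ι] [Nonempty ι] [∀ i, Finite (G i)]
    (hφ : ∀ i, Function.Injective (φ i)) : IsPiC (PushoutI φ) := by
  intro C hC
  obtain ⟨c, rfl⟩ := (Subgroup.isCyclic_iff_exists_zpowers_eq_top C).1 hC
  by_cases hfin : IsOfFinOrder c
  · have := residuallyFinite_pushoutI_of_finite hφ
    exact isFinitelySeparable_of_finite_subgroup (by simpa using hfin)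
  · apply isFinitelySeparable_of_hom
    intro g hg
    -- A factor element fixing a coset is conjugate into the torsion-free group ⟨c⟩, yet has finite
    -- order, so it is trivial. The base coset is fixed by `c` and moved by `g`.
    obtain ⟨Z, hZ, Φ, z, hc, hgz⟩ := exists_finite_hom_fix_move
      (W := PushoutI φ ⧸ zpowers c) hφ (fun i p w h => by
        obtain ⟨x, rfl⟩ := QuotientGroup.mk_surjective w
        have h1 : x⁻¹ * PushoutI.of i p⁻¹ * x ∈ zpowers c := by
          simpa [mul_assoc] using QuotientGroup.eq.1 h
        obtain ⟨k, hk⟩ := h1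
        have hk' : x⁻¹ * PushoutI.of i p⁻¹ * x = c ^ k := hk.symm
        have h2 : IsOfFinOrder (c ^ k) := by
          rw [← hk']
          have h3 : IsOfFinOrder (PushoutI.of i p⁻¹ : PushoutI φ) :=
            MonoidHom.isOfFinOrder _ (isOfFinOrder_of_finite _)
          have h4 := MonoidHom.isOfFinOrder (MulAut.conj x⁻¹).toMonoidHom h3
          simpa using h4
        have h3 : k = 0 := by
          by_contra hk0
          obtain ⟨n, hn, h1⟩ := isOfFinOrder_iff_zpow_eq_one.1 h2
          exact hfin (isOfFinOrder_iff_zpow_eq_one.2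
            ⟨k * n, mul_ne_zero hk0 hn, by rw [zpow_mul, h1]⟩)
        rw [h3, zpow_zero] at hk'
        have h4 : (PushoutI.of i p⁻¹ : PushoutI φ) = 1 := by
          simpa [mul_assoc, inv_mul_eq_one, mul_eq_right] using hk'
        simpa using PushoutI.of_injective hφ i (h4.trans (map_one _).symm))
      ((1 : PushoutI φ) : PushoutI φ ⧸ zpowers c) (c := c) (g := g)
      (QuotientGroup.eq.2 (by simp))
      (fun h => hg (by simpa using QuotientGroup.eq.1 h))
    refine ⟨Equiv.Perm Z, inferInstance, Φ, ?_, isFinitelySeparable_of_finite⟩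
    rintro ⟨_, ⟨k, rfl⟩, hk⟩
    refine hgz ?_
    rw [← hk]
    simp only [map_zpow]
    exact Equiv.Perm.zpow_apply_eq_self_of_apply_eq_self hc k

end FinitePushout

/-! ### Reduced and cyclically reduced words in an amalgam -/

section ReducedLists

open Monoid

variable {ι : Type*} {G : ι → Type*} {U : Type*} [∀ i, Group (G i)] [Group U]
  (φ : ∀ i, U →* G i)

/-- Lists of letters outside the amalgamated subgroup, adjacent ones from different factors. -/
def IsReducedList (l : List (Σ i, G i)) : Prop :=
  l.IsChain (fun x y => x.1 ≠ y.1) ∧ ∀ x ∈ l, x.2 ∉ (φ x.1).range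

/-- The element of the amalgam spelled by a list of letters. -/
def letterProd (l : List (Σ i, G i)) : PushoutI φ :=
  (l.map fun x => PushoutI.of x.1 x.2).prod

variable {φ}

@[simp]
theorem letterProd_nil : letterProd φ [] = 1 := rfl

@[simp]
theorem letterProd_cons (x : Σ i, G i) (l : List (Σ i, G i)) :
    letterProd φ (x :: l) = PushoutI.of x.1 x.2 * letterProd φ l := by
  simp [letterProd]

@[simp]
theorem letterProd_append (l l' : List (Σ i, G i)) :
    letterProd φ (l ++ l') = letterProd φ l * letterProd φ l' := by
  simp [letterProd]

theorem letterProd_flatten_replicate (l : List (Σ i, G i)) (n : ℕ) :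
    letterProd φ (List.replicate n l).flatten = letterProd φ l ^ n := by
  induction n with
  | zero => simp
  | succ n ih => rw [List.replicate_succ, List.flatten_cons, letterProd_append, ih, pow_succ']

namespace IsReducedList

theorem exists_word {l : List (Σ i, G i)} (h : IsReducedList φ l) :
    ∃ w : CoprodI.Word G, w.toList = l ∧ PushoutI.Reduced φ w ∧
      PushoutI.ofCoprodI w.prod = letterProd φ l := by
  refine ⟨⟨l, fun x hx h1 => h.2 x hx (h1 ▸ one_mem _), h.1⟩, rfl, fun x hx => h.2 x hx, ?_⟩
  simp [CoprodI.Word.prod, letterProd, map_list_prod, Function.comp_def]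

/-- Passing to normal form keeps the sequence of factors, and normal forms are unique. Length is
thus an invariant of the element. -/
theorem map_fst_eq (hφ : ∀ i, Function.Injective (φ i)) {l l' : List (Σ i, G i)}
    (h : IsReducedList φ l) (h' : IsReducedList φ l') (heq : letterProd φ l = letterProd φ l') :
    l.map Sigma.fst = l'.map Sigma.fst := by
  obtain ⟨d⟩ := PushoutI.NormalWord.transversal_nonempty φ hφ
  obtain ⟨w, rfl, hw, hp⟩ := h.exists_word
  obtain ⟨w', rfl, hw', hp'⟩ := h'.exists_word
  obtain ⟨v, hv, hvl⟩ := hw.exists_normalWord_prod_eq d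
  obtain ⟨v', hv', hvl'⟩ := hw'.exists_normalWord_prod_eq d
  have : v = v' := PushoutI.NormalWord.prod_injective (by rw [hv, hv', hp, hp', heq])
  rw [← hvl, ← hvl', this]

theorem eq_nil_of_mem_range (hφ : ∀ i, Function.Injective (φ i)) {l : List (Σ i, G i)}
    (h : IsReducedList φ l) (hl : letterProd φ l ∈ (PushoutI.base φ).range) : l = [] := by
  obtain ⟨w, rfl, hw, hp⟩ := h.exists_word
  rw [hw.eq_empty_of_mem_range hφ (hp ▸ hl)]
  rfl

theorem tail {x : Σ i, G i} {l : List (Σ i, G i)} (h : IsReducedList φ (x :: l)) :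
    IsReducedList φ l :=
  ⟨h.1.tail, fun y hy => h.2 y (List.mem_cons_of_mem _ hy)⟩

theorem replace_head {i : ι} {a b : G i} {l : List (Σ i, G i)}
    (h : IsReducedList φ (⟨i, a⟩ :: l)) (hb : b ∉ (φ i).range) :
    IsReducedList φ (⟨i, b⟩ :: l) := by
  obtain ⟨h1, h2⟩ := h
  refine ⟨?_, ?_⟩
  · rw [List.isChain_cons] at h1 ⊢
    exact h1
  · intro y hy
    obtain rfl | hy := List.mem_cons.1 hy
    · exact hb
    · exact h2 y (List.mem_cons_of_mem _ hy)

/-- Elements of the amalgamated subgroup are absorbed into the first letter. -/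
theorem base_mul {l : List (Σ i, G i)} (h : IsReducedList φ l) (hl : l ≠ []) (u : U) :
    ∃ l', IsReducedList φ l' ∧ l' ≠ [] ∧ l'.length = l.length ∧
      letterProd φ l' = PushoutI.base φ u * letterProd φ l := by
  obtain _ | ⟨⟨i, a⟩, l⟩ := l
  · exact absurd rfl hl
  · refine ⟨⟨i, φ i u * a⟩ :: l, h.replace_head ?_, by simp, by simp, ?_⟩
    · rw [mul_mem_cancel_left (show φ i u ∈ (φ i).range from ⟨u, rfl⟩)]
      exact h.2 _ List.mem_cons_self
    · simp [← PushoutI.of_apply_eq_base φ i, mul_assoc]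

theorem singleton {i : ι} {a : G i} (ha : a ∉ (φ i).range) : IsReducedList φ [⟨i, a⟩] :=
  ⟨List.isChain_singleton _, by simpa using ha⟩

/-- Reducedness of `l ++ l` encodes cyclic reducedness: it controls the only junction that occurs in
powers. -/
theorem flatten_replicate {l : List (Σ i, G i)} (hl : l ≠ []) (h : IsReducedList φ (l ++ l))
    (n : ℕ) : IsReducedList φ (List.replicate n l).flatten := by
  obtain ⟨h1, h2⟩ := h
  rw [List.isChain_append] at h1
  constructor
  · rw [List.isChain_flatten (fun h => hl (List.eq_of_mem_replicate h).symm)]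
    refine ⟨fun l' hl' => List.eq_of_mem_replicate hl' ▸ h1.1, ?_⟩
    exact List.isChain_replicate_of_rel _ h1.2.2
  · intro x hx
    obtain ⟨l', hl', hx⟩ := List.mem_flatten.1 hx
    rw [List.eq_of_mem_replicate hl'] at hx
    exact h2 x (List.mem_append_left _ hx)

end IsReducedList

theorem mem_base_range_or_exists_reducedList (g : PushoutI φ) :
    g ∈ (PushoutI.base φ).range ∨ ∃ l, IsReducedList φ l ∧ l ≠ [] ∧ letterProd φ l = g := by
  -- Closure under left multiplication is what can be proved by induction on generators.
  suffices h : ∀ x g : PushoutI φ,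
      (g ∈ (PushoutI.base φ).range ∨ ∃ l, IsReducedList φ l ∧ l ≠ [] ∧ letterProd φ l = g) →
      (x * g ∈ (PushoutI.base φ).range ∨
        ∃ l, IsReducedList φ l ∧ l ≠ [] ∧ letterProd φ l = x * g) by
    simpa using h g 1 (Or.inl (one_mem _))
  have hbase (u : U) (g : PushoutI φ) (hg : g ∈ (PushoutI.base φ).range ∨
      ∃ l, IsReducedList φ l ∧ l ≠ [] ∧ letterProd φ l = g) :
      PushoutI.base φ u * g ∈ (PushoutI.base φ).range ∨
        ∃ l, IsReducedList φ l ∧ l ≠ [] ∧ letterProd φ l = PushoutI.base φ u * g := by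
    obtain hg | ⟨l, hl, hne, rfl⟩ := hg
    · exact Or.inl (mul_mem ⟨u, rfl⟩ hg)
    · obtain ⟨l', h1, h2, -, h3⟩ := hl.base_mul hne u
      exact Or.inr ⟨l', h1, h2, h3⟩
  intro x
  induction x using PushoutI.induction_on with
  | base u => exact hbase u
  | mul x y hx hy => intro g hg; rw [mul_assoc]; exact hx _ (hy _ hg)
  | of i p =>
    intro g hg
    by_cases hp : p ∈ (φ i).range
    · obtain ⟨u, rfl⟩ := hp
      rw [PushoutI.of_apply_eq_base]
      exact hbase u g hg
    obtain ⟨u, rfl⟩ | ⟨l, hl, hne, rfl⟩ := hg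
    · refine Or.inr ⟨[⟨i, p * φ i u⟩], .singleton ?_, by simp, ?_⟩
      · rwa [mul_mem_cancel_right (show φ i u ∈ (φ i).range from ⟨u, rfl⟩)]
      · simp [PushoutI.of_apply_eq_base]
    obtain _ | ⟨⟨j, a⟩, l⟩ := l
    · exact absurd rfl hne
    by_cases hij : i = j
    · subst hij
      by_cases hpa : p * a ∈ (φ i).range
      · obtain ⟨u, hu⟩ := hpa
        have h1 : (PushoutI.of i p : PushoutI φ) * letterProd φ (⟨i, a⟩ :: l) =
            PushoutI.base φ u * letterProd φ l := by
          rw [← PushoutI.of_apply_eq_base φ i, hu]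
          simp [mul_assoc]
        rw [h1]
        refine hbase u _ ?_
        by_cases hl0 : l = []
        · exact Or.inl (hl0 ▸ one_mem _)
        · exact Or.inr ⟨l, hl.tail, hl0, rfl⟩
      · exact Or.inr ⟨⟨i, p * a⟩ :: l, hl.replace_head hpa, by simp, by simp [mul_assoc]⟩
    · refine Or.inr ⟨⟨i, p⟩ :: ⟨j, a⟩ :: l, ⟨List.isChain_cons_cons.2 ⟨hij, hl.1⟩, ?_⟩, by simp,
        by simp⟩
      intro y hy
      obtain rfl | hy := List.mem_cons.1 hy
      · exact hp
      · exact hl.2 y hy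

/-- If the end letters lie in one factor, conjugation by the last letter merges them and shortens
the word; if not, the word is already cyclically reduced. -/
theorem IsReducedList.exists_conj (l : List (Σ i, G i)) (h : IsReducedList φ l) (hne : l ≠ []) :
    ∃ x : PushoutI φ, (∃ i a, x * letterProd φ l * x⁻¹ = PushoutI.of i a) ∨
      ∃ l', l' ≠ [] ∧ IsReducedList φ (l' ++ l') ∧ x * letterProd φ l * x⁻¹ = letterProd φ l' := by
  induction hn : l.length using Nat.strong_induction_on generalizing l with
  | _ n ih =>
  obtain rfl | ⟨l₀, ⟨j, b⟩, rfl⟩ := List.eq_nil_or_concat' l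
  · exact absurd rfl hne
  obtain _ | ⟨⟨i, a⟩, l₁⟩ := l₀
  · exact ⟨1, Or.inl ⟨j, b, by simp⟩⟩
  by_cases hij : i = j
  · subst hij
    have hne₁ : l₁ ≠ [] := by
      rintro rfl
      have := h.1
      simp at this
    have hred : IsReducedList φ (⟨i, a⟩ :: l₁) :=
      ⟨(List.isChain_append.1 h.1).1, fun x hx => h.2 x (List.mem_append_left _ hx)⟩
    have hconj : (PushoutI.of i b : PushoutI φ) * letterProd φ (⟨i, a⟩ :: l₁ ++ [⟨i, b⟩]) *
        (PushoutI.of i b)⁻¹ = PushoutI.of i (b * a) * letterProd φ l₁ := by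
      simp [mul_assoc]
    obtain ⟨l', hl', hne', hlen, hp⟩ : ∃ l', IsReducedList φ l' ∧ l' ≠ [] ∧
        l'.length < n ∧ letterProd φ l' = PushoutI.of i (b * a) * letterProd φ l₁ := by
      by_cases hba : b * a ∈ (φ i).range
      · obtain ⟨u, hu⟩ := hba
        obtain ⟨l', h1, h2, h3, h4⟩ := hred.tail.base_mul hne₁ u
        refine ⟨l', h1, h2, ?_, ?_⟩
        · rw [h3, ← hn]; simp
        · rw [h4, ← hu, PushoutI.of_apply_eq_base]
      · exact ⟨⟨i, b * a⟩ :: l₁, hred.replace_head hba, by simp, by rw [← hn]; simp, by simp⟩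
    obtain ⟨x, hx⟩ := ih _ hlen l' hl' hne' rfl
    refine ⟨x * PushoutI.of i b, ?_⟩
    have h1 : x * PushoutI.of i b * letterProd φ (⟨i, a⟩ :: l₁ ++ [⟨i, b⟩]) *
        (x * PushoutI.of i b)⁻¹ = x * letterProd φ l' * x⁻¹ := by
      rw [hp, ← hconj]
      simp only [mul_inv_rev, mul_assoc]
    rwa [h1]
  · refine ⟨1, Or.inr ⟨_, hne, ⟨List.isChain_append.2 ⟨h.1, h.1, ?_⟩, ?_⟩, by simp⟩⟩
    · intro x hx y hy
      rw [List.getLast?_concat, Option.mem_some_iff] at hx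
      rw [List.cons_append, List.head?_cons, Option.mem_some_iff] at hy
      subst hx hy
      exact Ne.symm hij
    · intro x hx
      exact h.2 x ((List.mem_append.1 hx).elim id id)

/-- Every element of an amalgam is conjugate to an element of a factor or to one spelled by a
cyclically reduced list. -/
theorem exists_conj_of_or_cyclicallyReduced [Nonempty ι] (g : PushoutI φ) :
    ∃ x : PushoutI φ, (∃ i a, x * g * x⁻¹ = PushoutI.of i a) ∨
      ∃ l, l ≠ [] ∧ IsReducedList φ (l ++ l) ∧ x * g * x⁻¹ = letterProd φ l := by
  obtain ⟨u, rfl⟩ | ⟨l, hl, hne, rfl⟩ := mem_base_range_or_exists_reducedList g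
  · obtain ⟨i⟩ := ‹Nonempty ι›
    exact ⟨1, Or.inl ⟨i, φ i u, by simp [PushoutI.of_apply_eq_base]⟩⟩
  · exact hl.exists_conj l hne

end ReducedLists

/-! ### Separation in amalgams of finite quotients -/

section CompatibleFamilies

open Monoid Filter

variable {ι : Type} {G : ι → Type u} {U : Type u} [∀ i, Group (G i)] [Group U]

/-- Normal subgroups of finite index of the factors with a common trace on the amalgamated
subgroup. -/
structure CompatibleFamily (φ : ∀ i, U →* G i) where
  /-- The subgroups of the factors. -/
  N : ∀ i, FiniteIndexNormalSubgroup (G i)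
  /-- Their common trace on the amalgamated subgroup. -/
  L : Subgroup U
  normal : L.Normal
  comap_eq : ∀ i, (N i).toSubgroup.comap (φ i) = L

namespace CompatibleFamily

variable {φ : ∀ i, U →* G i}

instance (D : CompatibleFamily φ) : D.L.Normal := D.normal

/-- The maps of `U / L` to the finite quotients of the factors. -/
def quotientMap (D : CompatibleFamily φ) (i : ι) : U ⧸ D.L →* G i ⧸ (D.N i).toSubgroup :=
  QuotientGroup.map D.L (D.N i).toSubgroup (φ i) (D.comap_eq i).ge

/-- The amalgam of the finite quotients of the factors. -/
abbrev Quot (D : CompatibleFamily φ) : Type u := PushoutI D.quotientMap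

/-- The canonical homomorphism onto the amalgam of the finite quotients. -/
def hom (D : CompatibleFamily φ) : PushoutI φ →* D.Quot :=
  PushoutI.lift (fun i => (PushoutI.of i).comp (QuotientGroup.mk' (D.N i).toSubgroup))
    ((PushoutI.base D.quotientMap).comp (QuotientGroup.mk' D.L)) (fun i => by
      ext u
      exact PushoutI.of_apply_eq_base D.quotientMap i (QuotientGroup.mk u))

theorem hom_of (D : CompatibleFamily φ) (i : ι) (a : G i) :
    D.hom (PushoutI.of i a) = PushoutI.of i (QuotientGroup.mk a : G i ⧸ (D.N i).toSubgroup) := by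
  simp [hom]

theorem hom_base (D : CompatibleFamily φ) (u : U) :
    D.hom (PushoutI.base φ u) = PushoutI.base D.quotientMap (QuotientGroup.mk u) := by
  simp [hom]

theorem quotientMap_injective (D : CompatibleFamily φ) (i : ι) :
    Function.Injective (D.quotientMap i) := by
  rw [injective_iff_map_eq_one]
  intro u hu
  obtain ⟨u, rfl⟩ := QuotientGroup.mk_surjective u
  have h1 : φ i u ∈ (D.N i).toSubgroup := (QuotientGroup.eq_one_iff _).1 hu
  exact (QuotientGroup.eq_one_iff _).2 ((D.comap_eq i).le h1)

/-- The image of a list of letters in the finite quotients. -/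
def mapList (D : CompatibleFamily φ) (l : List (Σ i, G i)) :
    List (Σ i, G i ⧸ (D.N i).toSubgroup) :=
  l.map fun x => ⟨x.1, QuotientGroup.mk x.2⟩

theorem map_fst_mapList (D : CompatibleFamily φ) (l : List (Σ i, G i)) :
    (D.mapList l).map Sigma.fst = l.map Sigma.fst := by
  simp [mapList, Function.comp_def]

theorem mapList_append (D : CompatibleFamily φ) (l l' : List (Σ i, G i)) :
    D.mapList (l ++ l') = D.mapList l ++ D.mapList l' :=
  List.map_append

theorem mapList_ne_nil (D : CompatibleFamily φ) {l : List (Σ i, G i)} (hl : l ≠ []) :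
    D.mapList l ≠ [] :=
  fun h => hl (List.map_eq_nil_iff.1 h)

theorem length_mapList (D : CompatibleFamily φ) (l : List (Σ i, G i)) :
    (D.mapList l).length = l.length :=
  List.length_map _

theorem hom_letterProd (D : CompatibleFamily φ) (l : List (Σ i, G i)) :
    D.hom (letterProd φ l) = letterProd D.quotientMap (D.mapList l) := by
  induction l with
  | nil => simp [mapList]
  | cons x l ih =>
    rw [letterProd_cons, map_mul, ih, hom_of]
    simp [mapList]

/-- The filter of arbitrarily small compatible families. -/
def small (φ : ∀ i, U →* G i) : Filter (CompatibleFamily φ) :=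
  comap N atBot

/-- This lets finitely many eventual conditions be realized by a single family. -/
theorem small_neBot (h : ∀ M : ∀ i, FiniteIndexNormalSubgroup (G i),
    ∃ D : CompatibleFamily φ, ∀ i, D.N i ≤ M i) : (small φ).NeBot := by
  have : Nonempty (∀ i, FiniteIndexNormalSubgroup (G i)) := ⟨fun i => .ofSubgroup ⊤⟩
  rw [small, comap_neBot_iff]
  intro t ht
  obtain ⟨M, hM⟩ := mem_atBot_sets.1 ht
  obtain ⟨D, hD⟩ := h M
  exact ⟨D, hM _ hD⟩

theorem eventually_le {i : ι} (M : FiniteIndexNormalSubgroup (G i)) :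
    ∀ᶠ D in small φ, D.N i ≤ M := by
  classical
  have h : ∀ᶠ D in small φ,
      D.N ≤ Function.update (fun j => FiniteIndexNormalSubgroup.ofSubgroup (⊤ : Subgroup (G j))) i M :=
    tendsto_comap.eventually (eventually_le_atBot _)
  filter_upwards [h] with D hD
  simpa using hD i

theorem eventually_mk_notMem_map {i : ι} {F : Subgroup (G i)} (hF : IsFinitelySeparable F)
    {a : G i} (ha : a ∉ F) :
    ∀ᶠ D in small φ, (QuotientGroup.mk a : G i ⧸ (D.N i).toSubgroup) ∉
      F.map (QuotientGroup.mk' (D.N i).toSubgroup) := by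
  obtain ⟨M, hM⟩ := isFinitelySeparable_iff.1 hF a ha
  filter_upwards [eventually_le M] with D hD
  rintro ⟨f, hf, hfa⟩
  exact hM f hf (hD (QuotientGroup.eq.1 hfa))

theorem eventually_mk_notMem_range (hsep : ∀ i, IsFinitelySeparable (φ i).range) {i : ι} {a : G i}
    (ha : a ∉ (φ i).range) :
    ∀ᶠ D in small φ,
      (QuotientGroup.mk a : G i ⧸ (D.N i).toSubgroup) ∉ (D.quotientMap i).range := by
  filter_upwards [eventually_mk_notMem_map (hsep i) ha] with D hD
  rintro ⟨u, hu⟩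
  obtain ⟨u, rfl⟩ := QuotientGroup.mk_surjective u
  exact hD ⟨φ i u, ⟨u, rfl⟩, hu⟩

/-- Factor indices survive in the quotient, and only finitely many letters have to avoid the
amalgamated subgroup. -/
theorem eventually_isReducedList (hsep : ∀ i, IsFinitelySeparable (φ i).range)
    {l : List (Σ i, G i)} (hl : IsReducedList φ l) :
    ∀ᶠ D in small φ, IsReducedList D.quotientMap (D.mapList l) := by
  have h : ∀ᶠ D in small φ, ∀ x ∈ l,
      (QuotientGroup.mk x.2 : G x.1 ⧸ (D.N x.1).toSubgroup) ∉ (D.quotientMap x.1).range :=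
    (eventually_all_finite l.finite_toSet).2
      fun x hx => eventually_mk_notMem_range hsep (hl.2 x hx)
  filter_upwards [h] with D hD
  refine ⟨(List.isChain_map _).2 hl.1, fun y hy => ?_⟩
  obtain ⟨x, hx, rfl⟩ := List.mem_map.1 hy
  exact hD x hx

theorem eventually_hom_ne_one [Nonempty ι] (hφ : ∀ i, Function.Injective (φ i))
    (hres : ∀ i, Group.ResiduallyFinite (G i)) (hsep : ∀ i, IsFinitelySeparable (φ i).range)
    {g : PushoutI φ} (hg : g ≠ 1) : ∀ᶠ D in small φ, D.hom g ≠ 1 := by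
  obtain ⟨u, rfl⟩ | ⟨l, hl, hne, rfl⟩ := mem_base_range_or_exists_reducedList g
  · obtain ⟨i⟩ := ‹Nonempty ι›
    have hu : φ i u ≠ 1 := by
      intro h
      rw [hφ i (h.trans (map_one _).symm), map_one] at hg
      exact hg rfl
    obtain ⟨M, hM⟩ := Group.exists_finiteIndexNormalSubgroup_notMem _ hu
    filter_upwards [eventually_le M] with D hD h
    rw [hom_base] at h
    have h1 := PushoutI.base_injective D.quotientMap_injective (h.trans (map_one _).symm)
    exact hM (hD ((D.comap_eq i).ge ((QuotientGroup.eq_one_iff _).1 h1)))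
  · filter_upwards [eventually_isReducedList hsep hl] with D hD h
    rw [hom_letterProd] at h
    have h1 := hD.eq_nil_of_mem_range D.quotientMap_injective (h ▸ one_mem _)
    exact D.mapList_ne_nil hne h1

/-- Separation from the powers of an element of a factor. -/
theorem eventually_hom_notMem_zpowers_of
    (hsep : ∀ i, IsFinitelySeparable (φ i).range) {i : ι} {a : G i}
    (ha : IsFinitelySeparable (zpowers a)) {g : PushoutI φ}
    (hg : g ∉ zpowers (PushoutI.of i a : PushoutI φ)) :
    ∀ᶠ D in small φ, D.hom g ∉ zpowers (D.hom (PushoutI.of i a)) := by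
  by_cases hgi : g ∈ (PushoutI.of (φ := φ) i).range
  · obtain ⟨b, rfl⟩ := hgi
    have hb : b ∉ zpowers a := by
      rintro ⟨k, rfl⟩
      exact hg ⟨k, by simp⟩
    filter_upwards [eventually_mk_notMem_map ha hb] with D hD
    rintro ⟨k, hk⟩
    simp only [hom_of, ← map_zpow] at hk
    exact hD ⟨a ^ k, ⟨k, rfl⟩, PushoutI.of_injective D.quotientMap_injective i hk⟩
  obtain ⟨u, rfl⟩ | ⟨l, hl, hne, rfl⟩ := mem_base_range_or_exists_reducedList g
  · exact absurd ⟨φ i u, PushoutI.of_apply_eq_base φ i u⟩ hgi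
  filter_upwards [eventually_isReducedList hsep hl] with D hD
  rintro ⟨k, hk⟩
  simp only [hom_of, ← map_zpow, hom_letterProd] at hk
  -- The power has a reduced form of at most one letter; comparing with the form of `g` would put
  -- `g` in factor `i`.
  by_cases hr : (QuotientGroup.mk a ^ k : G i ⧸ (D.N i).toSubgroup) ∈ (D.quotientMap i).range
  · obtain ⟨u, hu⟩ := hr
    rw [← hu, PushoutI.of_apply_eq_base] at hk
    exact D.mapList_ne_nil hne (hD.eq_nil_of_mem_range D.quotientMap_injective ⟨u, hk⟩)
  · have h1 := (IsReducedList.singleton hr).map_fst_eq D.quotientMap_injective hD (by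
      simpa using hk)
    rw [map_fst_mapList] at h1
    obtain _ | ⟨⟨j, b⟩, _ | ⟨y, l⟩⟩ := l
    · exact hne rfl
    · obtain rfl : i = j := by simpa using h1
      exact hgi ⟨b, by simp⟩
    · simp at h1

theorem exists_reducedList_hom_pow (D : CompatibleFamily φ) {l : List (Σ i, G i)} (hl : l ≠ [])
    (hD : IsReducedList D.quotientMap (D.mapList (l ++ l))) (k : ℕ) :
    ∃ l', IsReducedList D.quotientMap l' ∧
      D.hom (letterProd φ l ^ k) = letterProd D.quotientMap l' ∧ k ≤ l'.length := by
  rw [mapList_append] at hD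
  refine ⟨(List.replicate k (D.mapList l)).flatten,
    hD.flatten_replicate (D.mapList_ne_nil hl) k, ?_, ?_⟩
  · rw [letterProd_flatten_replicate, map_pow, hom_letterProd]
  · rw [List.length_flatten, List.map_replicate, List.sum_replicate, length_mapList, smul_eq_mul]
    exact Nat.le_mul_of_pos_right k (List.length_pos_of_ne_nil hl)

/-- Separation from the powers of a cyclically reduced element. -/
theorem eventually_hom_notMem_zpowers_of_cyclicallyReduced [Nonempty ι]
    (hφ : ∀ i, Function.Injective (φ i)) (hres : ∀ i, Group.ResiduallyFinite (G i))
    (hsep : ∀ i, IsFinitelySeparable (φ i).range) {l : List (Σ i, G i)} (hl : l ≠ [])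
    (hred : IsReducedList φ (l ++ l)) {g : PushoutI φ} (hg : g ∉ zpowers (letterProd φ l)) :
    ∀ᶠ D in small φ, D.hom g ∉ zpowers (D.hom (letterProd φ l)) := by
  -- The bound is the length of `g`, hence independent of `D`. Using it for `g` and `g⁻¹` confines
  -- the integer exponents to a finite interval.
  have hlen (g : PushoutI φ) : ∃ n : ℕ, ∀ᶠ D : CompatibleFamily φ in small φ, ∀ k : ℕ,
      D.hom (letterProd φ l ^ k) = D.hom g → k ≤ n := by
    have hpow := eventually_isReducedList hsep hred
    obtain ⟨u, rfl⟩ | ⟨m, hm, -, rfl⟩ := mem_base_range_or_exists_reducedList g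
    · refine ⟨0, ?_⟩
      filter_upwards [hpow] with D hD k hk
      obtain ⟨l', h1, h2, h3⟩ := D.exists_reducedList_hom_pow hl hD k
      rw [h2, hom_base] at hk
      rwa [h1.eq_nil_of_mem_range D.quotientMap_injective ⟨_, hk.symm⟩] at h3
    · refine ⟨m.length, ?_⟩
      filter_upwards [hpow, eventually_isReducedList hsep hm] with D hD hDm k hk
      obtain ⟨l', h1, h2, h3⟩ := D.exists_reducedList_hom_pow hl hD k
      rw [h2, hom_letterProd] at hk
      have h4 := congrArg List.length (h1.map_fst_eq D.quotientMap_injective hDm hk)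
      rw [List.length_map, List.length_map, length_mapList] at h4
      exact h3.trans h4.le
  obtain ⟨n, hn⟩ := hlen g
  obtain ⟨n', hn'⟩ := hlen g⁻¹
  have hfin : ∀ᶠ D in small φ, ∀ k ∈ Set.Icc (-n' : ℤ) n,
      D.hom (g⁻¹ * letterProd φ l ^ k) ≠ 1 := by
    refine (eventually_all_finite (Set.finite_Icc _ _)).2 fun k _ => ?_
    refine eventually_hom_ne_one hφ hres hsep fun h => hg ⟨k, ?_⟩
    exact (inv_mul_eq_one.1 h).symm
  filter_upwards [hn, hn', hfin] with D h1 h2 h3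
  rintro ⟨k, hk⟩
  have hk' : D.hom (letterProd φ l ^ k) = D.hom g := by rw [map_zpow]; exact hk
  refine h3 k ⟨?_, ?_⟩ (by rw [map_mul, map_inv, hk', inv_mul_cancel])
  · obtain ⟨m, rfl | rfl⟩ := k.eq_nat_or_neg
    · omega
    · have := h2 m (by
        rw [map_inv, ← hk', ← map_inv, zpow_neg, zpow_natCast, inv_inv])
      omega
  · obtain ⟨m, rfl | rfl⟩ := k.eq_nat_or_neg
    · have := h1 m (by rw [← hk', zpow_natCast])
      omega
    · omega

end CompatibleFamily

open CompatibleFamily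

/-- Under a filtration by compatible families, a cyclic subgroup of an amalgam is finitely
separable as soon as those of its conjugates lying in a factor are finitely separable there. -/
theorem isFinitelySeparable_zpowers_pushoutI [Finite ι] [Nonempty ι] {φ : ∀ i, U →* G i}
    (hφ : ∀ i, Function.Injective (φ i)) (hres : ∀ i, Group.ResiduallyFinite (G i))
    (hsep : ∀ i, IsFinitelySeparable (φ i).range)
    (hcof : ∀ M : ∀ i, FiniteIndexNormalSubgroup (G i),
      ∃ D : CompatibleFamily φ, ∀ i, D.N i ≤ M i) (c : PushoutI φ)
    (hc : ∀ (x : PushoutI φ) (i : ι) (a : G i), x * c * x⁻¹ = PushoutI.of i a →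
      IsFinitelySeparable (zpowers a)) : IsFinitelySeparable (zpowers c) := by
  have := small_neBot hcof
  have hmain (c : PushoutI φ)
      (h : ∀ g ∉ zpowers c, ∀ᶠ D in small φ, D.hom g ∉ zpowers (D.hom c)) :
      IsFinitelySeparable (zpowers c) := by
    refine isFinitelySeparable_of_hom fun g hg => ?_
    obtain ⟨D, hD⟩ := (h g hg).exists
    refine ⟨D.Quot, inferInstance, D.hom, by rwa [MonoidHom.map_zpowers], ?_⟩
    exact isPiC_pushoutI_of_finite D.quotientMap_injective _ (by
      rw [MonoidHom.map_zpowers]; infer_instance)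
  obtain ⟨x, ⟨i, a, hx⟩ | ⟨l, hl, hred, hx⟩⟩ := exists_conj_of_or_cyclicallyReduced c
  · refine isFinitelySeparable_zpowers_of_conj (x := x) (hmain _ fun g hg => ?_)
    rw [hx] at hg ⊢
    exact eventually_hom_notMem_zpowers_of hsep (hc x i a hx) hg
  · refine isFinitelySeparable_zpowers_of_conj (x := x) (hmain _ fun g hg => ?_)
    rw [hx] at hg ⊢
    exact eventually_hom_notMem_zpowers_of_cyclicallyReduced hφ hres hsep hl hred hg

end CompatibleFamilies

/-! ### Specialization to two factors -/

section TwoFactors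

open Amalgam Monoid

variable {A B : Type u} [Group A] [Group B] (H : Subgroup A) (K : Subgroup B) (φ : H ≃* K)

theorem embed_injective : ∀ i, Function.Injective (embed H K φ i)
  | false => H.subtype_injective
  | true => K.subtype_injective.comp φ.injective

theorem range_embed_false : (embed H K φ false).range = H := H.range_subtype

theorem range_embed_true : (embed H K φ true).range = K := by
  ext b
  constructor
  · rintro ⟨h, rfl⟩
    exact (φ h).2
  · intro hb
    exact ⟨φ.symm ⟨b, hb⟩, congrArg Subtype.val (φ.apply_symm_apply ⟨b, hb⟩)⟩

variable {H K φ}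

/-- As `φ` is injective, compatibility says that `R` and `S` pull back to the same subgroup of `H`.
-/
theorem exists_compatibleFamily_of_mem_compatiblePairs {p : Subgroup A × Subgroup B}
    (hp : p ∈ compatiblePairs H K φ) :
    ∃ D : CompatibleFamily (embed H K φ),
      (D.N false).toSubgroup = p.1 ∧ (D.N true).toSubgroup = p.2 := by
  obtain ⟨R, S⟩ := p
  obtain ⟨hR, hR', hS, hS', h⟩ := hp
  let N : ∀ i, FiniteIndexNormalSubgroup (Factor A B i)
    | false => { toSubgroup := R, isNormal' := hR, isFiniteIndex' := hR' }
    | true => { toSubgroup := S, isNormal' := hS, isFiniteIndex' := hS' }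
  refine ⟨⟨N, R.subgroupOf H, hR.subgroupOf H, ?_⟩, rfl, rfl⟩
  rintro (_ | _)
  · rfl
  · change (S.subgroupOf K).comap φ.toMonoidHom = R.subgroupOf H
    rw [← show (R.subgroupOf H).map φ.toMonoidHom = S.subgroupOf K from h]
    exact comap_map_eq_self_of_injective φ.injective _

end TwoFactors

theorem theorem1p3 {A B : Type u} [Group A] [Group B]
    (H : Subgroup A) (K : Subgroup B) (φ : H ≃* K)
    (hA : Group.ResiduallyFinite A) (hB : Group.ResiduallyFinite B)
    (hH : IsFinitelySeparable H) (hK : IsFinitelySeparable K)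
    (hΩ : ∀ (M : Subgroup A) (N : Subgroup B), M.Normal → M.FiniteIndex → N.Normal →
      N.FiniteIndex → ∃ p ∈ Amalgam.compatiblePairs H K φ, p.1 ≤ M ∧ p.2 ≤ N) :
    (∀ C : Subgroup (Amalgam.Product H K φ), IsCyclic C →
      (∀ D ∈ nonSeparableCyclic A, ¬ AreConjugate C (D.map (Amalgam.inA H K φ))) →
      (∀ D ∈ nonSeparableCyclic B, ¬ AreConjugate C (D.map (Amalgam.inB H K φ))) →
      IsFinitelySeparable C) ∧
    (IsPiC A → IsPiC B → IsPiC (Amalgam.Product H K φ)) := by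
  have hres : ∀ i, Group.ResiduallyFinite (Amalgam.Factor A B i)
    | false => hA
    | true => hB
  have hsep : ∀ i, IsFinitelySeparable (Amalgam.embed H K φ i).range
    | false => (range_embed_false H K φ).symm ▸ hH
    | true => (range_embed_true H K φ).symm ▸ hK
  have hcof (M : ∀ i, FiniteIndexNormalSubgroup (Amalgam.Factor A B i)) :
      ∃ D : CompatibleFamily (Amalgam.embed H K φ), ∀ i, D.N i ≤ M i := by
    obtain ⟨p, hp, h1, h2⟩ := hΩ (M false).toSubgroup (M true).toSubgroup
      (M false).isNormal' (M false).isFiniteIndex' (M true).isNormal' (M true).isFiniteIndex'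
    obtain ⟨D, hD1, hD2⟩ := exists_compatibleFamily_of_mem_compatiblePairs hp
    refine ⟨D, ?_⟩
    rintro (_ | _)
    · exact hD1.le.trans h1
    · exact hD2.le.trans h2
  have hmain (C : Subgroup (Amalgam.Product H K φ)) (hC : IsCyclic C)
      (hCA : ∀ D ∈ nonSeparableCyclic A, ¬ AreConjugate C (D.map (Amalgam.inA H K φ)))
      (hCB : ∀ D ∈ nonSeparableCyclic B, ¬ AreConjugate C (D.map (Amalgam.inB H K φ))) :
      IsFinitelySeparable C := by
    obtain ⟨c, rfl⟩ := (Subgroup.isCyclic_iff_exists_zpowers_eq_top C).1 hC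
    have hconj {X : Type u} [Group X] (f : X →* Amalgam.Product H K φ)
        (x : Amalgam.Product H K φ) (a : X) (h : x * c * x⁻¹ = f a) :
        AreConjugate (zpowers c) ((zpowers a).map f) := by
      refine ⟨x⁻¹, ?_⟩
      rw [MonoidHom.map_zpowers, MonoidHom.map_zpowers, ← h]
      simp [mul_assoc]
    refine isFinitelySeparable_zpowers_pushoutI (embed_injective H K φ) hres hsep hcof c ?_
    rintro x (_ | _) a hx
    · change A at a
      by_contra ha
      exact hCA (zpowers a) ⟨inferInstance, ha⟩ (hconj (Amalgam.inA H K φ) x a hx)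
    · change B at a
      by_contra ha
      exact hCB (zpowers a) ⟨inferInstance, ha⟩ (hconj (Amalgam.inB H K φ) x a hx)
  -- For π_c factors the excluded families are empty.
  exact ⟨hmain, fun hPA hPB C hC => hmain C hC (fun D hD _ => hD.2 (hPA D hD.1))
    (fun D hD _ => hD.2 (hPB D hD.1))⟩
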